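/- Influence is played by Left and Right on a finite directed graph $G$ whose vertex set $V(G)$ is partitioned into sets $L$ and $R$. The players alternate. On his turn Left chooses a remaining vertex $x\in L$ and removes all vertices reachable from $x$ by directed paths in the current graph (including $x$); on his turn Right chooses a remaining vertex $y\in R$ and removes all vertices from which $y$ is reachable (including $y$). A player who has no vertex of his label left to choose removes nothing more, and the opponent then removes all the remaining vertices. The score of a player is the total number of vertices he has removed. Let $Ls(G)$ (resp. $Rs(G)$) be the score of Left minus the score of Right under optimal play when Left (resp. Right) moves first. A segment is a directed graph whose vertex set is a set of at least two consecutive integers, in which $L$ is the set of even vertices, $R$ is the set of odd vertices, and the arcs are exactly the pairs $(2i,2i+1)$ and $(2i,2i-1)$ with both ends in the vertex set. Every segment $G$ has exactly one of the following types, according to the value of $|L|-|R|\in\{0,-1,1\}$. 1. If $G$ has an even number of vertices ($|L|=|R|$), then $Ls(G)\in\{2,4\}$ and $Rs(G)\in\{-2,-4\}$. 2. If $G$ has an odd number of vertices and $|L|-|R|=-1$, then $Ls(G)\in\{1,3\}$ and $Rs(G)\in\{-1,-3,-5\}$; moreover, if $|L|$ is odd, then $Ls(G)=3$. 3. If $G$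 has an odd number of vertices and $|L|-|R|=1$, then $Ls(G)\in\{1,3,5\}$ and $Rs(G)\in\{-1,-3\}$; moreover, if $|L|$ is even, then $Rs(G)=-3$. Consequently, for every segment, $0<Ls(G)\le 5$ and $-5\le Rs(G)<0$: the player who moves first always gets strictly more than his opponent, and the difference of the scores is at most $5$. -/

import Mathlib

/-- A position of the game: a finite directed graph whose vertices lie in `V` and are partitioned
into the vertices `L` labelled Left and the vertices `R` labelled Right. -/
structure InfluenceGraph (V : Type*) where
  L : Finset V
  R : Finset V
  arc : V → V → Prop
  disjoint_LR : Disjoint L R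
  arc_mem : ∀ x y, arc x y → (x ∈ L ∨ x ∈ R) ∧ (y ∈ L ∨ y ∈ R)

namespace InfluenceGraph

variable {V : Type*} [DecidableEq V]

/-- The vertex set `V(G)`. -/
def verts (G : InfluenceGraph V) : Finset V := G.L ∪ G.R

/-- `G \ S`: the subgraph of `G` induced by the vertices that are not in `S`. -/
def remove (G : InfluenceGraph V) (S : Finset V) : InfluenceGraph V where
  L := G.L \ S
  R := G.R \ S
  arc x y := G.arc x y ∧ x ∉ S ∧ y ∉ S
  disjoint_LR := G.disjoint_LR.mono Finset.sdiff_subset Finset.sdiff_subset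
  arc_mem := by
    rintro x y ⟨h, hx, hy⟩
    have := G.arc_mem x y h
    simpa [hx, hy] using this

open Classical in
/-- `Succ(G, x)`: the vertices reachable from `x` by a directed path of `G`, including `x`. -/
noncomputable def succ (G : InfluenceGraph V) (x : V) : Finset V :=
  G.verts.filter fun z => Relation.ReflTransGen G.arc x z

open Classical in
/-- `Pred(G, y)`: the vertices from which `y` is reachable by a directed path of `G`,
including `y`. -/
noncomputable def pred (G : InfluenceGraph V) (y : V) : Finset V :=
  G.verts.filter fun z => Relation.ReflTransGen G.arc z y

theorem card_verts_remove_lt (G : InfluenceGraph V) {S : Finset V} {x : V}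
    (hx : x ∈ G.verts) (hS : x ∈ S) : (G.remove S).verts.card < G.verts.card := by
  apply Finset.card_lt_card
  rw [Finset.ssubset_iff_of_subset]
  · exact ⟨x, hx, by simp [verts, remove, hS]⟩
  · intro z hz
    simp only [verts, remove, Finset.mem_union, Finset.mem_sdiff] at hz ⊢
    tauto

theorem card_remove_succ_lt (G : InfluenceGraph V) {x : V} (hx : x ∈ G.L) :
    (G.remove (G.succ x)).verts.card < G.verts.card := by
  have h : x ∈ G.verts := Finset.mem_union_left _ hx
  exact G.card_verts_remove_lt h (by simp [succ, h, Relation.ReflTransGen.refl])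

theorem card_remove_pred_lt (G : InfluenceGraph V) {y : V} (hy : y ∈ G.R) :
    (G.remove (G.pred y)).verts.card < G.verts.card := by
  have h : y ∈ G.verts := Finset.mem_union_right _ hy
  exact G.card_verts_remove_lt h (by simp [pred, h, Relation.ReflTransGen.refl])

mutual

/-- `s₁ᴸ(G)`: the best number of vertices Left can remove when Left moves first. Left, to move,
picks `x ∈ L` and removes `Succ(G, x)`. If `L` is empty, Left never removes anything. -/
noncomputable def s1L (G : InfluenceGraph V) : ℕ :=
  if h : G.L.Nonempty then
    G.L.attach.sup' (by simpa using h)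
      (fun x => (G.succ x.1).card + s2L (G.remove (G.succ x.1)))
  else 0
termination_by G.verts.card
decreasing_by exact G.card_remove_succ_lt x.2

/-- `s₂ᴸ(G)`: the best number of vertices Left can remove when Right moves first. Right, to move,
picks `y ∈ R` and removes `Pred(G, y)`. If `R` is empty, Left ends up removing every vertex. -/
noncomputable def s2L (G : InfluenceGraph V) : ℕ :=
  if h : G.R.Nonempty then
    G.R.attach.inf' (by simpa using h) (fun y => s1L (G.remove (G.pred y.1)))
  else G.verts.card
termination_by G.verts.card
decreasing_by exact G.card_remove_pred_lt y.2

end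

mutual

/-- `s₁ᴿ(G)`: the best number of vertices Right can remove when Right moves first. -/
noncomputable def s1R (G : InfluenceGraph V) : ℕ :=
  if h : G.R.Nonempty then
    G.R.attach.sup' (by simpa using h)
      (fun y => (G.pred y.1).card + s2R (G.remove (G.pred y.1)))
  else 0
termination_by G.verts.card
decreasing_by exact G.card_remove_pred_lt y.2

/-- `s₂ᴿ(G)`: the best number of vertices Right can remove when Left moves first. -/
noncomputable def s2R (G : InfluenceGraph V) : ℕ :=
  if h : G.L.Nonempty then
    G.L.attach.inf' (by simpa using h) (fun x => s1R (G.remove (G.succ x.1)))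
  else G.verts.card
termination_by G.verts.card
decreasing_by exact G.card_remove_succ_lt x.2

end

/-- The Left-score: Left's score minus Right's score when Left starts. -/
noncomputable def Ls (G : InfluenceGraph V) : ℤ := (s1L G : ℤ) - (s2R G : ℤ)

/-- The Right-score: Left's score minus Right's score when Right starts. -/
noncomputable def Rs (G : InfluenceGraph V) : ℤ := (s2L G : ℤ) - (s1R G : ℤ)

/-- A segment: an alternated path on at least two consecutive integers, the even ones being the
Left vertices and the odd ones the Right vertices, whose arcs are exactly those from an even
vertex to the neighbouring odd vertices. -/
structure IsSegment (G : InfluenceGraph ℤ) : Prop where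
  consecutive : ∀ i j k : ℤ, i ∈ G.verts → j ∈ G.verts → i ≤ k → k ≤ j → k ∈ G.verts
  two_le_card : 2 ≤ G.verts.card
  mem_L : ∀ i : ℤ, i ∈ G.L ↔ i ∈ G.verts ∧ Even i
  mem_R : ∀ i : ℤ, i ∈ G.R ↔ i ∈ G.verts ∧ Odd i
  arc_iff : ∀ i j : ℤ, G.arc i j ↔
    i ∈ G.verts ∧ j ∈ G.verts ∧ Even i ∧ (j = i + 1 ∨ j = i - 1)

/-- A segment in the class `C₌`: it has an even number of vertices. -/
def IsSegmentEq (G : InfluenceGraph ℤ) : Prop :=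
  G.IsSegment ∧ Even G.verts.card

/-- A segment in the class `C₊`: it has an odd number of vertices and `|L| - |R| = 1`. -/
def IsSegmentPlus (G : InfluenceGraph ℤ) : Prop :=
  G.IsSegment ∧ Odd G.verts.card ∧ (G.L.card : ℤ) - (G.R.card : ℤ) = 1

/-- A segment in the class `C₋`: it has an odd number of vertices and `|L| - |R| = -1`. -/
def IsSegmentMinus (G : InfluenceGraph ℤ) : Prop :=
  G.IsSegment ∧ Odd G.verts.card ∧ (G.L.card : ℤ) - (G.R.card : ℤ) = -1

end InfluenceGraph

-- Every arc goes from a Left to a Right vertex, so directed paths have length at most one and each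
-- move deletes a vertex with its surviving neighbours. Positions reached from a segment are
-- therefore disjoint unions of alternating paths, and `E`, `P`, `M` with `LMove` describe the whole
-- game. The two scores sum to the number of vertices, so `Ls` and `Rs` have the parity of that
-- number, and it suffices to bound them within a few units. Exchanging the players turns upper
-- bounds into lower ones, so only strategies for Right are needed.
--
-- Two kinds of strategy suffice. The first limits what Left can gain: in a union of even paths and
-- isolated vertices, a Left move creates at most one longer odd path, which Right at once splits
-- into even paths (`evenPos_bounds`, `EvenPos.lLe_cons_P`). This gives the bounds 4, 5 and 3 when
-- Left starts on `E`, `P` and `M`, and with one further cut the bound -1 when Right starts on `M`.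
--
-- The second shows that Right profits from starting on `E` or `P`: he takes 3 vertices near the
-- middle, leaving two pieces that cancel or nearly cancel, and then imitates Left (`Mirror.lLe`,
-- `almost_mirror_bounds`, `lLe_M_E`). The leftover advantage of Left is at most 0, 2 or 1. The
-- shortest `E` needs only an end move.

namespace SegmentGame

-- Alternating paths, their disjoint unions, and moves

/-- The connected alternating paths: `E k` has `2 * k` vertices, `P k` has `2 * k + 1` vertices
with both ends labelled Left, `M k` has `2 * k + 1` vertices with both ends labelled Right. -/
inductive Path
  | E (k : ℕ)
  | P (k : ℕ)
  | M (k : ℕ)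

namespace Path

/-- Exchange the two players. -/
def neg : Path → Path
  | E k => E k
  | P k => M k
  | M k => P k

@[simp] theorem neg_E (k : ℕ) : neg (E k) = E k := rfl
@[simp] theorem neg_P (k : ℕ) : neg (P k) = M k := rfl
@[simp] theorem neg_M (k : ℕ) : neg (M k) = P k := rfl
@[simp] theorem neg_neg (c : Path) : c.neg.neg = c := by cases c <;> rfl

/-- The number of Left vertices. -/
def nl : Path → ℕ
  | E k => k
  | P k => k + 1
  | M k => k

/-- The number of Right vertices. -/
def nr : Path → ℕ
  | E k => k
  | P k => k
  | M k => k + 1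

@[simp] theorem nl_neg (c : Path) : c.neg.nl = c.nr := by cases c <;> rfl
@[simp] theorem nr_neg (c : Path) : c.neg.nr = c.nl := by cases c <;> rfl

end Path

open SegmentGame.Path

/-- A position: a disjoint union of alternating paths. -/
abbrev Pos := Multiset Path

namespace Pos

/-- Exchange the two players. -/
def neg (X : Pos) : Pos := X.map Path.neg

/-- The number of Left vertices. -/
def nl (X : Pos) : ℕ := (X.map Path.nl).sum

/-- The number of Right vertices. -/
def nr (X : Pos) : ℕ := (X.map Path.nr).sum

/-- The number of vertices. -/
def size (X : Pos) : ℕ := nl X + nr X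

@[simp] theorem neg_zero : neg 0 = 0 := rfl
@[simp] theorem neg_cons (c : Path) (X : Pos) : neg (c ::ₘ X) = c.neg ::ₘ neg X := by simp [neg]
@[simp] theorem neg_singleton (c : Path) : neg {c} = {c.neg} := by simp [neg]
@[simp] theorem neg_add (X Y : Pos) : neg (X + Y) = neg X + neg Y := by simp [neg]
@[simp] theorem neg_neg (X : Pos) : neg (neg X) = X := by simp [neg]

@[simp] theorem nl_zero : nl 0 = 0 := rfl
@[simp] theorem nr_zero : nr 0 = 0 := rfl
@[simp] theorem nl_cons (c : Path) (X : Pos) : nl (c ::ₘ X) = c.nl + nl X := by simp [nl]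
@[simp] theorem nr_cons (c : Path) (X : Pos) : nr (c ::ₘ X) = c.nr + nr X := by simp [nr]
@[simp] theorem nl_singleton (c : Path) : nl {c} = c.nl := by simp [nl]
@[simp] theorem nr_singleton (c : Path) : nr {c} = c.nr := by simp [nr]
@[simp] theorem nl_add (X Y : Pos) : nl (X + Y) = nl X + nl Y := by simp [nl]
@[simp] theorem nr_add (X Y : Pos) : nr (X + Y) = nr X + nr Y := by simp [nr]
@[simp] theorem nl_neg (X : Pos) : nl (neg X) = nr X := by simp [nl, nr, neg]
@[simp] theorem nr_neg (X : Pos) : nr (neg X) = nl X := by simp [nl, nr, neg]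

end Pos

open SegmentGame.Pos

/-- `LMove c g W`: in the path `c` Left can remove `g` vertices and leave `W`. -/
inductive LMove : Path → ℤ → Pos → Prop
  | E_end (k : ℕ) : LMove (E (k + 1)) 2 {E k}
  | E_mid (k c d : ℕ) (h : c + d + 2 = k) : LMove (E k) 3 {P c, E d}
  | P_one : LMove (P 0) 1 0
  | P_end (k : ℕ) : LMove (P (k + 1)) 2 {P k}
  | P_mid (k c d : ℕ) (h : c + d + 2 = k) : LMove (P k) 3 {P c, P d}
  | M_mid (k c d : ℕ) (h : c + d + 1 = k) : LMove (M k) 3 {E c, E d}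

/-- `LOpt X g Y`: Left can move from `X` to `Y`, removing `g` vertices. -/
def LOpt (X : Pos) (g : ℤ) (Y : Pos) : Prop :=
  ∃ c Z W, X = c ::ₘ Z ∧ LMove c g W ∧ Y = W + Z

/-- `ROpt X g Y`: Right can move from `X` to `Y`, removing `g` vertices. -/
def ROpt (X : Pos) (g : ℤ) (Y : Pos) : Prop := LOpt (neg X) g (neg Y)

theorem LMove.size_eq {c : Path} {g : ℤ} {W : Pos} (h : LMove c g W) :
    (c.nl + c.nr : ℤ) = g + (nl W + nr W : ℤ) := by
  cases h <;> simp [Path.nl, Path.nr] <;> omega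

theorem LMove.pos {c : Path} {g : ℤ} {W : Pos} (h : LMove c g W) : 0 < g := by
  cases h <;> norm_num

theorem LOpt.size_eq {X Y : Pos} {g : ℤ} (h : LOpt X g Y) : (size X : ℤ) = g + size Y := by
  obtain ⟨c, Z, W, rfl, hm, rfl⟩ := h
  have := hm.size_eq
  simp [size]
  linarith

theorem LOpt.pos {X Y : Pos} {g : ℤ} (h : LOpt X g Y) : 0 < g := by
  obtain ⟨c, Z, W, rfl, hm, rfl⟩ := h
  exact hm.pos

theorem LOpt.size_lt {X Y : Pos} {g : ℤ} (h : LOpt X g Y) : size Y < size X := by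
  have := h.size_eq
  have := h.pos
  omega

@[simp] theorem size_neg (X : Pos) : size (neg X) = size X := by simp [size, add_comm]

theorem ROpt.size_lt {X Y : Pos} {g : ℤ} (h : ROpt X g Y) : size Y < size X := by
  simpa using LOpt.size_lt h

theorem lOpt_add {X₁ X₂ : Pos} {g : ℤ} {Y : Pos} :
    LOpt (X₁ + X₂) g Y ↔
      (∃ Y₁, LOpt X₁ g Y₁ ∧ Y = Y₁ + X₂) ∨ ∃ Y₂, LOpt X₂ g Y₂ ∧ Y = X₁ + Y₂ := by
  constructor
  · rintro ⟨c, Z, W, hX, hm, rfl⟩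
    have hc : c ∈ X₁ + X₂ := by simp [hX]
    rcases Multiset.mem_add.1 hc with h | h
    · obtain ⟨T, rfl⟩ := Multiset.exists_cons_of_mem h
      refine Or.inl ⟨W + T, ⟨c, T, W, rfl, hm, rfl⟩, ?_⟩
      rw [Multiset.cons_add, Multiset.cons_inj_right] at hX
      rw [← hX, add_assoc]
    · obtain ⟨T, rfl⟩ := Multiset.exists_cons_of_mem h
      refine Or.inr ⟨W + T, ⟨c, T, W, rfl, hm, rfl⟩, ?_⟩
      rw [Multiset.add_cons, Multiset.cons_inj_right] at hX
      rw [← hX, add_left_comm]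
  · rintro (⟨Y₁, ⟨c, Z, W, rfl, hm, rfl⟩, rfl⟩ | ⟨Y₂, ⟨c, Z, W, rfl, hm, rfl⟩, rfl⟩)
    · exact ⟨c, Z + X₂, W, by simp, hm, by simp [add_assoc]⟩
    · exact ⟨c, X₁ + Z, W, by simp, hm, by rw [add_left_comm]⟩

theorem lOpt_singleton {c : Path} {g : ℤ} {Y : Pos} : LOpt {c} g Y ↔ LMove c g Y := by
  constructor
  · rintro ⟨d, Z, W, h, hm, rfl⟩
    obtain ⟨rfl, rfl⟩ := (Multiset.singleton_eq_cons_iff _).1 h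
    simpa using hm
  · exact fun h => ⟨c, 0, Y, rfl, h, by simp⟩

theorem lOpt_cons {c : Path} {X : Pos} {g : ℤ} {Y : Pos} :
    LOpt (c ::ₘ X) g Y ↔
      (∃ W, LMove c g W ∧ Y = W + X) ∨ ∃ X', LOpt X g X' ∧ Y = c ::ₘ X' := by
  rw [← Multiset.singleton_add, lOpt_add]
  simp only [lOpt_singleton, Multiset.singleton_add]

theorem not_lOpt_zero {g : ℤ} {Y : Pos} : ¬ LOpt 0 g Y := by
  rintro ⟨c, Z, W, h, -⟩
  exact Multiset.zero_ne_cons h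

theorem LMove.rOpt {c : Path} {g : ℤ} {W : Pos} (h : LMove c.neg g W) (X : Pos) :
    ROpt (c ::ₘ X) g (neg W + X) :=
  ⟨c.neg, neg X, W, by simp, h, by simp⟩

-- Certificates for upper bounds

mutual

/-- `LLe X s`: if Left moves first from `X`, then Right can keep the score of Left minus the score
of Right at most `s`. -/
inductive LLe : Pos → ℤ → Prop
  | mk {X : Pos} {s : ℤ} (h : ∀ g Y, LOpt X g Y → RLe Y (s - g))
      (h0 : nl X = 0 → -(nr X : ℤ) ≤ s) : LLe X s

/-- `RLe X s`: if Right moves first from `X`, then Right can keep the score of Left minus the score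
of Right at most `s`. -/
inductive RLe : Pos → ℤ → Prop
  | move {X Y : Pos} {g s : ℤ} (h : ROpt X g Y) (h' : LLe Y (s + g)) : RLe X s
  | terminal {X : Pos} {s : ℤ} (h : nr X = 0) (h' : (nl X : ℤ) ≤ s) : RLe X s

end

mutual

theorem LLe.mono {X : Pos} {s t : ℤ} (hst : s ≤ t) : LLe X s → LLe X t
  | .mk h h0 => .mk (fun g Y hY => RLe.mono (by linarith) (h g Y hY)) fun e => (h0 e).trans hst

theorem RLe.mono {X : Pos} {s t : ℤ} (hst : s ≤ t) : RLe X s → RLe X t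
  | .move h h' => .move h (LLe.mono (by linarith) h')
  | .terminal h h' => .terminal h (h'.trans hst)

end

theorem LLe.of_eq {X Y : Pos} {s t : ℤ} (h : LLe X s) (e : Y = X) (hst : s ≤ t) : LLe Y t :=
  e ▸ h.mono hst

theorem RLe.of_eq {X Y : Pos} {s t : ℤ} (h : RLe X s) (e : Y = X) (hst : s ≤ t) : RLe Y t :=
  e ▸ h.mono hst

theorem RLe.of_mid_P {X : Pos} {s : ℤ} {k : ℕ} (c d : ℕ) (hk : c + d + 1 = k)
    (h : LLe (E c ::ₘ E d ::ₘ X) (s + 3)) : RLe (P k ::ₘ X) s :=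
  .move (by simpa using (LMove.M_mid k c d hk).rOpt (c := P k) X) h

theorem RLe.of_mid_E {X : Pos} {s : ℤ} {k : ℕ} (c d : ℕ) (hk : c + d + 2 = k)
    (h : LLe (M c ::ₘ E d ::ₘ X) (s + 3)) : RLe (E k ::ₘ X) s :=
  .move (by simpa using (LMove.E_mid k c d hk).rOpt (c := E k) X) h

theorem RLe.of_mid_M {X : Pos} {s : ℤ} {k : ℕ} (c d : ℕ) (hk : c + d + 2 = k)
    (h : LLe (M c ::ₘ M d ::ₘ X) (s + 3)) : RLe (M k ::ₘ X) s :=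
  .move (by simpa using (LMove.P_mid k c d hk).rOpt (c := M k) X) h

theorem RLe.of_end_E {X : Pos} {s : ℤ} (k : ℕ) (h : LLe (E k ::ₘ X) (s + 2)) :
    RLe (E (k + 1) ::ₘ X) s :=
  .move (by simpa using (LMove.E_end k).rOpt (c := E (k + 1)) X) h

theorem RLe.of_end_M {X : Pos} {s : ℤ} (k : ℕ) (h : LLe (M k ::ₘ X) (s + 2)) :
    RLe (M (k + 1) ::ₘ X) s :=
  .move (by simpa using (LMove.P_end k).rOpt (c := M (k + 1)) X) h

theorem RLe.of_one_M {X : Pos} {s : ℤ} (h : LLe X (s + 1)) : RLe (M 0 ::ₘ X) s :=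
  .move (by simpa using LMove.P_one.rOpt (c := M 0) X) h

/-! ### Unions of even paths and isolated vertices -/

/-- The value of an isolated vertex. -/
def Path.val : Path → ℤ
  | P 0 => 1
  | M 0 => -1
  | _ => 0

/-- The number of isolated Left vertices minus the number of isolated Right vertices. -/
def Pos.val (X : Pos) : ℤ := (X.map Path.val).sum

@[simp] theorem val_zero : val 0 = 0 := rfl
@[simp] theorem val_cons (c : Path) (X : Pos) : val (c ::ₘ X) = c.val + val X := by simp [Pos.val]
@[simp] theorem val_add (X Y : Pos) : val (X + Y) = val X + val Y := by simp [Pos.val]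
@[simp] theorem val_singleton (c : Path) : val {c} = c.val := by simp [Pos.val]
@[simp] theorem val_E (k : ℕ) : (E k).val = 0 := rfl
@[simp] theorem val_P_zero : (P 0).val = 1 := rfl
@[simp] theorem val_M_zero : (M 0).val = -1 := rfl
@[simp] theorem val_P_succ (k : ℕ) : (P (k + 1)).val = 0 := rfl
@[simp] theorem val_M_succ (k : ℕ) : (M (k + 1)).val = 0 := rfl

theorem Path.neg_nr_le_val (c : Path) : -(c.nr : ℤ) ≤ c.val := by
  rcases c with k | (_ | k) | (_ | k) <;> (simp [Path.nr]; try omega)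

theorem neg_nr_le_val (X : Pos) : -(nr X : ℤ) ≤ val X := by
  induction X using Multiset.induction_on with
  | empty => simp
  | cons c X ih =>
    have := c.neg_nr_le_val
    simp only [nr_cons, val_cons]
    push_cast
    linarith

/-- `X` consists of isolated vertices and of even paths with at most `2 * m` vertices. -/
def EvenPos (m : ℕ) (X : Pos) : Prop := ∀ c ∈ X, c = P 0 ∨ c = M 0 ∨ ∃ k ≤ m, c = E k

theorem EvenPos.zero (m : ℕ) : EvenPos m 0 := by simp [EvenPos]

@[simp] theorem evenPos_cons {m : ℕ} {c : Path} {X : Pos} :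
    EvenPos m (c ::ₘ X) ↔ (c = P 0 ∨ c = M 0 ∨ ∃ k ≤ m, c = E k) ∧ EvenPos m X := by
  simp [EvenPos]

theorem EvenPos.mono {m n : ℕ} {X : Pos} (h : EvenPos m X) (hmn : m ≤ n) : EvenPos n X := by
  intro c hc
  rcases h c hc with h | h | ⟨k, hk, h⟩
  · exact Or.inl h
  · exact Or.inr (Or.inl h)
  · exact Or.inr (Or.inr ⟨k, hk.trans hmn, h⟩)

/-- The options of Left from a union of even paths. -/
theorem EvenPos.lOpt {m : ℕ} {X Y : Pos} {g : ℤ} (hX : EvenPos m X) (h : LOpt X g Y) :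
    (EvenPos m Y ∧ g = 1 ∧ val Y = val X - 1) ∨
    (EvenPos m Y ∧ g = 2 ∧ val Y = val X ∧ 1 ≤ m) ∨
    ∃ c Z, Y = P c ::ₘ Z ∧ EvenPos m Z ∧ g = 3 ∧ val Z = val X ∧ 2 ≤ m := by
  obtain ⟨c, Z, W, rfl, hm, rfl⟩ := h
  rw [evenPos_cons] at hX
  obtain ⟨hc | hc | ⟨k, hk, hc⟩, hZ⟩ := hX
  · subst hc
    cases hm with
    | P_one => exact Or.inl ⟨by simpa using hZ, rfl, by simp⟩
    | P_mid _ c d h => omega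
  · subst hc
    cases hm with
    | M_mid _ c d h => omega
  · subst hc
    cases hm with
    | E_end k =>
      exact Or.inr (Or.inl ⟨by simpa using ⟨by omega, hZ⟩, rfl, by simp, by omega⟩)
    | E_mid _ c d h =>
      exact Or.inr (Or.inr ⟨c, E d ::ₘ Z, by simp, by simpa using ⟨by omega, hZ⟩, rfl,
        by simp, by omega⟩)

/-- Right keeps the position even and otherwise plays greedily. The term `2 * min m 2` records the
longest even path available: his smaller moves, of 2 or 1 vertices, are made only when no longer
even path remains, and then Left's next gain is correspondingly smaller. -/
theorem evenPos_bounds (n : ℕ) : ∀ X : Pos, size X = n →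
    (∀ m, EvenPos m X → LLe X (val X + 2 * (min m 2 : ℕ))) ∧ ∀ m, EvenPos m X → RLe X (val X) := by
  induction n using Nat.strong_induction_on with
  | _ n ih =>
  intro X hn
  constructor
  · intro m hX
    refine .mk (fun g Y hY => ?_) (fun _ => ?_)
    · have hlt := hY.size_lt
      obtain ⟨h, rfl, hv⟩ | ⟨h, rfl, hv, hm⟩ | ⟨c, Z, rfl, h, rfl, hv, hm⟩ := hX.lOpt hY
      · exact ((ih _ (hn ▸ hlt) Y rfl).2 m h).mono (by omega)
      · exact ((ih _ (hn ▸ hlt) Y rfl).2 m h).mono (by omega)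
      · rcases c with _ | c
        · exact ((ih _ (hn ▸ hlt) _ rfl).2 m (by simpa using h)).mono (by simp; omega)
        -- Right takes 3 in return and splits the new odd path into even ones; the two gains cancel.
        · refine (RLe.of_mid_P (k := c + 1) (s := val X + 1) 0 c (by omega) ?_).mono (by omega)
          have h3 : size (E 0 ::ₘ E c ::ₘ Z) < n := by
            simp [size, Path.nl, Path.nr] at hlt hn ⊢
            omega
          refine ((ih _ h3 _ rfl).1 (max c m) ?_).mono (by simp; omega)
          simpa using h.mono (le_max_right c m)
    · have := neg_nr_le_val X
      omega
  · intro m hX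
    by_cases h2 : ∃ k, E (k + 2) ∈ X
    · obtain ⟨k, hk⟩ := h2
      obtain ⟨Z, rfl⟩ := Multiset.exists_cons_of_mem hk
      -- Taking 3 and isolating a Right vertex, worth one more, offsets the 4 that Left may gain
      -- next.
      refine RLe.of_mid_E 0 k (by omega) ?_
      have h3 : size (M 0 ::ₘ E k ::ₘ Z) < n := by
        simp [size, Path.nl, Path.nr] at hn ⊢
        omega
      simp only [evenPos_cons] at hX
      refine ((ih _ h3 _ rfl).1 (max k m) ?_).mono (by simp; omega)
      simpa using hX.2.mono (le_max_right k m)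
    by_cases h1 : E 1 ∈ X
    · have hX1 : EvenPos 1 X := by
        intro c hc
        rcases hX c hc with h | h | ⟨k, hk, rfl⟩
        · exact Or.inl h
        · exact Or.inr (Or.inl h)
        · refine Or.inr (Or.inr ⟨k, ?_, rfl⟩)
          by_contra hk1
          exact h2 ⟨k - 2, by rwa [Nat.sub_add_cancel (by omega)]⟩
      obtain ⟨Z, rfl⟩ := Multiset.exists_cons_of_mem h1
      apply RLe.of_end_E 0
      have h3 : size (E 0 ::ₘ Z) < n := by
        simp [size, Path.nl, Path.nr] at hn ⊢
        omega
      simp only [evenPos_cons] at hX1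
      exact ((ih _ h3 _ rfl).1 1 (by simpa using hX1.2)).mono (by simp)
    have hX0 : ∀ c ∈ X, c = P 0 ∨ c = M 0 ∨ c = E 0 := by
      intro c hc
      rcases hX c hc with h | h | ⟨k, hk, rfl⟩
      · exact Or.inl h
      · exact Or.inr (Or.inl h)
      · rcases k with _ | _ | k
        · simp
        · exact absurd hc h1
        · exact absurd ⟨k, hc⟩ h2
    by_cases h0 : M 0 ∈ X
    · obtain ⟨Z, rfl⟩ := Multiset.exists_cons_of_mem h0
      apply RLe.of_one_M
      have h3 : size Z < n := by
        simp [size, Path.nl, Path.nr] at hn ⊢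
        omega
      refine ((ih _ h3 _ rfl).1 0 fun c hc => ?_).mono (by simp)
      rcases hX0 c (by simp [hc]) with h | h | h <;> simp [h]
    -- Only isolated Left vertices and empty paths remain, so Right is out of moves.
    · have key : ∀ X : Pos, (∀ c ∈ X, c = P 0 ∨ c = E 0) → nr X = 0 ∧ (nl X : ℤ) = val X := by
        intro X
        induction X using Multiset.induction_on with
        | empty => simp
        | cons c X ih =>
          intro h
          obtain ⟨h1, h2⟩ := ih fun c hc => h c (by simp [hc])
          rcases h c (by simp) with rfl | rfl <;> simp [Path.nr, Path.nl, h1, h2]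
      obtain ⟨h3, h4⟩ := key X fun c hc => by
        rcases hX0 c hc with h | h | h
        · exact Or.inl h
        · exact absurd (h ▸ hc) h0
        · exact Or.inr h
      exact .terminal h3 h4.le

theorem EvenPos.lLe {m : ℕ} {X : Pos} (h : EvenPos m X) : LLe X (val X + 4) :=
  ((evenPos_bounds _ X rfl).1 m h).mono (by omega)

theorem EvenPos.rLe {m : ℕ} {X : Pos} (h : EvenPos m X) : RLe X (val X) :=
  (evenPos_bounds _ X rfl).2 m h

/-- One odd path next to even paths: Right moves first. -/
theorem EvenPos.rLe_cons_P {m : ℕ} {X : Pos} (h : EvenPos m X) (a : ℕ) :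
    RLe (P a ::ₘ X) (val X + 1) := by
  rcases a with _ | a
  · exact (EvenPos.rLe (m := m) (by simpa using h)).mono (by simp [add_comm])
  · refine RLe.of_mid_P 0 a (by omega) ((EvenPos.lLe (m := max a m) ?_).mono (by simp; omega))
    simpa using h.mono (le_max_right a m)

/-- One odd path next to even paths: Left moves first. -/
theorem EvenPos.lLe_cons_P (n : ℕ) : ∀ (X : Pos) (a m : ℕ), size (P a ::ₘ X) = n →
    EvenPos m X → LLe (P a ::ₘ X) (val X + 5) := by
  induction n using Nat.strong_induction_on with
  | _ n ih =>
  -- After a Left move there are at most two odd paths. Right splits one, gaining 3 against the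
  -- inductive bound 5; a single vertex is instead counted in `val`.
  have two : ∀ (X : Pos) (a b m : ℕ), size (P a ::ₘ P b ::ₘ X) < n → EvenPos m X →
      RLe (P a ::ₘ P b ::ₘ X) (val X + 2) := by
    intro X a b m hn hX
    wlog hb : b = 0 generalizing a b
    · obtain ⟨b, rfl⟩ := Nat.exists_eq_succ_of_ne_zero hb
      rw [Multiset.cons_swap]
      refine RLe.of_mid_P 0 b (by omega) ?_
      rw [Multiset.cons_swap (E b), Multiset.cons_swap (E 0)]
      have h3 : size (P a ::ₘ E 0 ::ₘ E b ::ₘ X) < n := by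
        simp [size, Path.nl, Path.nr] at hn ⊢
        omega
      refine (ih _ h3 _ a (max b m) rfl ?_).mono (by simp; omega)
      simpa using hX.mono (le_max_right b m)
    · subst hb
      exact (EvenPos.rLe_cons_P (m := m) (by simpa using hX) a).mono (by simp; omega)
  intro X a m hn hX
  refine .mk (fun g Y hY => ?_) (fun h0 => ?_)
  · have hlt := hY.size_lt
    rw [lOpt_cons] at hY
    obtain ⟨W, hm, rfl⟩ | ⟨X', hX', rfl⟩ := hY
    · cases hm with
      | P_one => exact (EvenPos.rLe (m := m) (by simpa using hX)).mono (by simp)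
      | P_end k =>
        rw [Multiset.singleton_add]
        exact (hX.rLe_cons_P k).mono (by omega)
      | P_mid _ c d h =>
        have e : ({P c, P d} : Pos) + X = P c ::ₘ P d ::ₘ X := by simp
        rw [e] at hlt ⊢
        exact (two X c d m (hn ▸ hlt) hX).mono (by omega)
    · obtain ⟨h, rfl, hv⟩ | ⟨h, rfl, hv, hm⟩ | ⟨c, Z, rfl, h, rfl, hv, hm⟩ := hX.lOpt hX'
      · exact (h.rLe_cons_P a).mono (by omega)
      · exact (h.rLe_cons_P a).mono (by omega)
      · exact (two Z a c m (hn ▸ hlt) h).mono (by omega)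
  · simp [Path.nl] at h0

/-! ### Adding a position and its negative -/

/-- `W` is the union of a position and of its negative. -/
def Mirror (W : Pos) : Prop := ∃ Z, W = Z + Pos.neg Z

theorem Mirror.zero : Mirror 0 := ⟨0, by simp⟩

theorem Mirror.cons_cons {W : Pos} (h : Mirror W) (c : Path) : Mirror (c ::ₘ c.neg ::ₘ W) := by
  obtain ⟨Z, rfl⟩ := h
  refine ⟨c ::ₘ Z, ?_⟩
  rw [neg_cons]
  simp only [← Multiset.singleton_add]
  abel

theorem Mirror.cons_cons_E {W : Pos} (h : Mirror W) (k : ℕ) : Mirror (E k ::ₘ E k ::ₘ W) :=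
  h.cons_cons (E k)

theorem Mirror.cons_cons_P {W : Pos} (h : Mirror W) (k : ℕ) : Mirror (P k ::ₘ M k ::ₘ W) :=
  h.cons_cons (P k)

/-- Right answers in the other copy. -/
theorem Mirror.reply {W Y : Pos} {g : ℤ} (hW : Mirror W) (h : LOpt W g Y) :
    ∃ Y', ROpt Y g Y' ∧ Mirror Y' := by
  obtain ⟨Z, rfl⟩ := hW
  rcases lOpt_add.1 h with ⟨Y₁, h₁, rfl⟩ | ⟨Y₂, h₂, rfl⟩
  · refine ⟨Y₁ + Pos.neg Y₁, ?_, Y₁, rfl⟩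
    have : LOpt (Pos.neg Y₁ + Z) g (Pos.neg Y₁ + Y₁) := lOpt_add.2 (Or.inr ⟨Y₁, h₁, rfl⟩)
    simpa [ROpt] using this
  · refine ⟨Pos.neg Y₂ + Y₂, ?_, Pos.neg Y₂, by simp⟩
    have : LOpt (Pos.neg Z + Pos.neg Y₂) g (Y₂ + Pos.neg Y₂) := lOpt_add.2 (Or.inl ⟨Y₂, h₂, rfl⟩)
    simpa [ROpt] using this

theorem ROpt.add_left {X Y : Pos} {g : ℤ} (h : ROpt X g Y) (A : Pos) : ROpt (A + X) g (A + Y) := by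
  unfold ROpt
  rw [Pos.neg_add, Pos.neg_add]
  exact lOpt_add.2 (Or.inr ⟨_, h, rfl⟩)

-- `E 0` is the empty path. Keeping it as a component spares special cases when a cut leaves nothing
-- on one side.
mutual

theorem LLe.cons_E_zero {X : Pos} {s : ℤ} : LLe X s → LLe (E 0 ::ₘ X) s
  | .mk h h0 => .mk (fun g Y hY => by
      obtain ⟨W, hm, -⟩ | ⟨X', h', rfl⟩ := lOpt_cons.1 hY
      · cases hm with
        | E_mid _ c d h => omega
      · exact RLe.cons_E_zero (h g X' h')) (by simpa [Path.nl, Path.nr] using h0)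

theorem RLe.cons_E_zero {X : Pos} {s : ℤ} : RLe X s → RLe (E 0 ::ₘ X) s
  | .move h h' => .move (by simpa using h.add_left {E 0}) (LLe.cons_E_zero h')
  | .terminal h h' => .terminal (by simpa [Path.nr] using h) (by simpa [Path.nl] using h')

end

/-- Right copies any move made in `W`, gaining the same amount, so only Left moves in `A` need
separate answers. -/
theorem LLe.of_mirror {A W : Pos} {s : ℤ} (hW : Mirror W) (h0 : -(nr A : ℤ) ≤ s)
    (hA : ∀ g B, LOpt A g B → RLe (B + W) (s - g))
    (ih : ∀ W', Mirror W' → size (A + W') < size (A + W) → LLe (A + W') s) : LLe (A + W) s := by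
  refine .mk (fun g Y hY => ?_) (fun _ => ?_)
  · have hlt := hY.size_lt
    rcases lOpt_add.1 hY with ⟨Y₁, h₁, rfl⟩ | ⟨Y₂, h₂, rfl⟩
    · exact hA g Y₁ h₁
    · obtain ⟨Y', h', hY'⟩ := hW.reply h₂
      have h'' := h'.add_left A
      exact .move h'' ((ih Y' hY' (h''.size_lt.trans hlt)).mono (by omega))
  · simp only [nr_add]
    push_cast
    omega

theorem Mirror.lLe (n : ℕ) : ∀ W, size W = n → Mirror W → LLe W 0 := by
  induction n using Nat.strong_induction_on with
  | _ n ih =>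
  intro W hn hW
  rw [← zero_add W] at hn ⊢
  refine .of_mirror hW (by simp) (fun g B h => absurd h not_lOpt_zero) fun W' hW' hlt => ?_
  rw [zero_add] at hlt ⊢
  exact ih _ (hn ▸ hlt) _ rfl hW'

/-- Paths whose lengths differ by two nearly cancel. -/
theorem almost_mirror_bounds (n : ℕ) : ∀ W, Mirror W →
    (size W = n → RLe W 0) ∧
    (size (P 0 ::ₘ W) = n → LLe (P 0 ::ₘ W) 1) ∧
    (∀ a, size (E (a + 1) ::ₘ E a ::ₘ W) = n → LLe (E (a + 1) ::ₘ E a ::ₘ W) 2) ∧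
    (∀ a, size (P (a + 1) ::ₘ M a ::ₘ W) = n → LLe (P (a + 1) ::ₘ M a ::ₘ W) 2) := by
  induction n using Nat.strong_induction_on with
  | _ n ih =>
  -- The last three positions are what a mirror position becomes when Right takes an end of one
  -- component; Left may then regain just the 1 or 2 vertices that Right took.
  have ih1 : ∀ W, Mirror W → size W < n → RLe W 0 := fun W hW h => (ih _ h W hW).1 rfl
  have ih2 : ∀ W, Mirror W → size (P 0 ::ₘ W) < n → LLe (P 0 ::ₘ W) 1 :=
    fun W hW h => (ih _ h W hW).2.1 rfl
  have ih3 : ∀ W a, Mirror W → size (E (a + 1) ::ₘ E a ::ₘ W) < n →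
      LLe (E (a + 1) ::ₘ E a ::ₘ W) 2 := fun W a hW h => (ih _ h W hW).2.2.1 a rfl
  have ih4 : ∀ W a, Mirror W → size (P (a + 1) ::ₘ M a ::ₘ W) < n →
      LLe (P (a + 1) ::ₘ M a ::ₘ W) 2 := fun W a hW h => (ih _ h W hW).2.2.2 a rfl
  clear ih
  intro W hW
  refine ⟨fun hn => ?_, fun hn => ?_, fun a hn => ?_, fun a hn => ?_⟩
  · obtain ⟨Z, rfl⟩ := hW
    by_cases hZ : ∃ c ∈ Z, c ≠ E 0
    · obtain ⟨c, hc, hc0⟩ := hZ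
      obtain ⟨Z, rfl⟩ := Multiset.exists_cons_of_mem hc
      have hW : Mirror (Z + Pos.neg Z) := ⟨Z, rfl⟩
      have e : c ::ₘ Z + Pos.neg (c ::ₘ Z) = c.neg ::ₘ c ::ₘ (Z + Pos.neg Z) := by
        rw [neg_cons]
        simp only [← Multiset.singleton_add]
        abel
      rw [e] at hn ⊢
      rcases c with (_ | k) | (_ | k) | (_ | k)
      · exact absurd rfl hc0
      · refine RLe.of_end_E k ?_
        rw [Multiset.cons_swap]
        refine ih3 _ _ hW ?_
        simp [size, Path.nl, Path.nr] at hn ⊢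
        omega
      · refine RLe.of_one_M (ih2 _ hW ?_)
        simp [size, Path.nl, Path.nr] at hn ⊢
        omega
      · refine RLe.of_end_M k ?_
        rw [Multiset.cons_swap]
        refine ih4 _ _ hW ?_
        simp [size, Path.nl, Path.nr] at hn ⊢
        omega
      · rw [Path.neg_M, Multiset.cons_swap] at hn ⊢
        refine RLe.of_one_M (ih2 _ hW ?_)
        simp [size, Path.nl, Path.nr] at hn ⊢
        omega
      · rw [Path.neg_M, Multiset.cons_swap] at hn ⊢
        refine RLe.of_end_M k ?_
        rw [Multiset.cons_swap]
        refine ih4 _ _ hW ?_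
        simp [size, Path.nl, Path.nr] at hn ⊢
        omega
    · push Not at hZ
      obtain ⟨m, rfl⟩ : ∃ m, Z = Multiset.replicate m (E 0) :=
        ⟨_, Multiset.eq_replicate_card.2 hZ⟩
      exact .terminal (by simp [Pos.neg, Pos.nr, Path.nr])
        (by simp [Pos.neg, Pos.nl, Path.nl])
  · have e : ∀ W : Pos, P 0 ::ₘ W = {P 0} + W := fun W => by simp
    rw [e] at hn ⊢
    refine .of_mirror hW (by simp [Path.nr]) (fun g B h => ?_) fun W' hW' hlt => ?_
    · cases lOpt_singleton.1 h with
      | P_one =>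
        exact (ih1 W hW (by simp [size, Path.nl, Path.nr] at hn ⊢; omega)).of_eq (by simp) (by simp)
      | P_mid _ c d h => omega
    · rw [← e]
      exact ih2 _ hW' (by rw [e]; omega)
  · have e : ∀ W : Pos, E (a + 1) ::ₘ E a ::ₘ W = {E (a + 1), E a} + W := fun W => by simp
    rw [e] at hn ⊢
    refine .of_mirror hW (by simp [Path.nr]; omega) (fun g B h => ?_) fun W' hW' hlt => ?_
    · obtain ⟨V, hm, rfl⟩ | ⟨_, h', rfl⟩ := lOpt_cons.1 h
      · generalize hk : a + 1 = k at hm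
        cases hm with
        | E_end b =>
          obtain rfl : a = b := by omega
          exact (ih1 _ (hW.cons_cons_E a) (by simp [size, Path.nl, Path.nr] at hn ⊢; omega)).of_eq
            (by simp only [← Multiset.singleton_add]; abel) (by simp)
        | E_mid _ c d h =>
          -- Right wants to cut `M c` off `E a` to cancel `P c`, leaving a partner of `E d` shorter
          -- by two vertices. If `d = 0` there is no such partner, and the shortfall moves to the
          -- partner of the odd piece; if also `c = 0`, an end move is all that remains.
          rcases d with _ | d
          · rcases c with _ | c
            · obtain rfl : a = 1 := by omega
              refine (RLe.of_end_E 0 (X := {P 0, E 0} + W) (s := -1) ?_).of_eq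
                (by simp only [Multiset.insert_eq_cons, ← Multiset.singleton_add]; abel) (by simp)
              exact (ih2 _ (hW.cons_cons_E 0)
                (by simp [size, Path.nl, Path.nr] at hn ⊢; omega)).of_eq
                (by simp only [Multiset.insert_eq_cons, ← Multiset.singleton_add]; abel) (by simp)
            · obtain rfl : a = c + 2 := by omega
              refine (RLe.of_mid_E (k := c + 2) c 0 (by omega) (X := {P (c + 1), E 0} + W)
                (s := -1) ?_).of_eq
                (by simp only [Multiset.insert_eq_cons, ← Multiset.singleton_add]; abel) (by simp)
              exact (ih4 _ c (hW.cons_cons_E 0)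
                (by simp [size, Path.nl, Path.nr] at hn ⊢; omega)).of_eq
                (by simp only [Multiset.insert_eq_cons, ← Multiset.singleton_add]; abel) (by simp)
          · refine (RLe.of_mid_E (k := a) c d (by omega) (X := {P c, E (d + 1)} + W)
              (s := -1) ?_).of_eq
              (by simp only [Multiset.insert_eq_cons, ← Multiset.singleton_add]; abel) (by simp)
            exact (ih3 _ d (hW.cons_cons_P c)
              (by simp [size, Path.nl, Path.nr] at hn ⊢; omega)).of_eq
              (by simp only [Multiset.insert_eq_cons, ← Multiset.singleton_add]; abel) (by simp)
      · cases lOpt_singleton.1 h' with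
        | E_end b =>
          refine (RLe.of_end_E (b + 1) (X := {E b} + W) (s := 0) ?_).of_eq
            (by simp only [← Multiset.singleton_add]; abel) (by simp)
          exact (ih3 _ b hW (by simp [size, Path.nl, Path.nr] at hn ⊢; omega)).of_eq
            (by simp only [← Multiset.singleton_add]) (by simp)
        | E_mid _ c d h =>
          refine (RLe.of_mid_E (k := a + 1) c (d + 1) (by omega) (X := {P c, E d} + W)
            (s := -1) ?_).of_eq
            (by simp only [Multiset.insert_eq_cons, ← Multiset.singleton_add]; abel) (by simp)
          exact (ih3 _ d (hW.cons_cons_P c) (by simp [size, Path.nl, Path.nr] at hn ⊢; omega)).of_eq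
            (by simp only [Multiset.insert_eq_cons, ← Multiset.singleton_add]; abel) (by simp)
    · rw [← e]
      exact ih3 _ _ hW' (by rw [e]; omega)
  · have e : ∀ W : Pos, P (a + 1) ::ₘ M a ::ₘ W = {P (a + 1), M a} + W := fun W => by simp
    rw [e] at hn ⊢
    refine .of_mirror hW (by simp [Path.nr]; omega) (fun g B h => ?_) fun W' hW' hlt => ?_
    · obtain ⟨V, hm, rfl⟩ | ⟨_, h', rfl⟩ := lOpt_cons.1 h
      · generalize hk : a + 1 = k at hm
        cases hm with
        | P_one => omega
        | P_end b =>
          obtain rfl : a = b := by omega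
          exact (ih1 _ (hW.cons_cons_P a) (by simp [size, Path.nl, Path.nr] at hn ⊢; omega)).of_eq
            (by simp only [← Multiset.singleton_add]; abel) (by simp)
        | P_mid _ c d h =>
          -- The same trichotomy, with odd pieces on both sides.
          rcases d with _ | d
          · rcases c with _ | c
            · obtain rfl : a = 1 := by omega
              refine (RLe.of_end_M 0 (X := {P 0, P 0} + W) (s := -1) ?_).of_eq
                (by simp only [Multiset.insert_eq_cons, ← Multiset.singleton_add]; abel) (by simp)
              exact (ih2 _ (hW.cons_cons_P 0)
                (by simp [size, Path.nl, Path.nr] at hn ⊢; omega)).of_eq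
                (by simp only [Multiset.insert_eq_cons, ← Multiset.singleton_add]; abel) (by simp)
            · refine (RLe.of_mid_M (k := a) c 0 (by omega) (X := {P (c + 1), P 0} + W)
                (s := -1) ?_).of_eq
                (by simp only [Multiset.insert_eq_cons, ← Multiset.singleton_add]; abel) (by simp)
              exact (ih4 _ c (hW.cons_cons_P 0)
                (by simp [size, Path.nl, Path.nr] at hn ⊢; omega)).of_eq
                (by simp only [Multiset.insert_eq_cons, ← Multiset.singleton_add]; abel) (by simp)
          · refine (RLe.of_mid_M (k := a) c d (by omega) (X := {P c, P (d + 1)} + W)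
              (s := -1) ?_).of_eq
              (by simp only [Multiset.insert_eq_cons, ← Multiset.singleton_add]; abel) (by simp)
            exact (ih4 _ d (hW.cons_cons_P c)
              (by simp [size, Path.nl, Path.nr] at hn ⊢; omega)).of_eq
              (by simp only [Multiset.insert_eq_cons, ← Multiset.singleton_add]; abel) (by simp)
      · cases lOpt_singleton.1 h' with
        | M_mid _ c d h =>
          refine (RLe.of_mid_P (k := a + 1) c (d + 1) (by omega) (X := {E c, E d} + W)
            (s := -1) ?_).of_eq
            (by simp only [Multiset.insert_eq_cons, ← Multiset.singleton_add]; abel) (by simp)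
          exact (ih3 _ d (hW.cons_cons_E c) (by simp [size, Path.nl, Path.nr] at hn ⊢; omega)).of_eq
            (by simp only [Multiset.insert_eq_cons, ← Multiset.singleton_add]; abel) (by simp)
    · rw [← e]
      exact ih4 _ _ hW' (by rw [e]; omega)

/-- An odd path with Right ends and an even path whose lengths differ by one. -/
theorem lLe_M_E (n : ℕ) : ∀ W c d, Mirror W → d = c ∨ d = c + 1 →
    size (M c ::ₘ E d ::ₘ W) = n → LLe (M c ::ₘ E d ::ₘ W) 1 := by
  induction n using Nat.strong_induction_on with
  | _ n ih =>
  have ih : ∀ W c d, Mirror W → d = c ∨ d = c + 1 → size (M c ::ₘ E d ::ₘ W) < n →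
    LLe (M c ::ₘ E d ::ₘ W) 1 := fun W c d hW hcd h => ih _ h W c d hW hcd rfl
  intro W c d hW hcd hn
  have e : ∀ W : Pos, M c ::ₘ E d ::ₘ W = {M c, E d} + W := fun W => by simp
  rw [e] at hn ⊢
  refine .of_mirror hW (by simp [Path.nr]; omega) (fun g B h => ?_) fun W' hW' hlt => ?_
  · obtain ⟨V, hm, rfl⟩ | ⟨_, h', rfl⟩ := lOpt_cons.1 h
    · cases hm with
      | M_mid _ i j h =>
        -- In general Right's answer leaves a cancelling pair and a smaller pair of the same kind,
        -- with `d = c` and `d = c + 1` interchanged. In the exceptional case he takes an end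
        -- instead and everything cancels.
        by_cases hj : j = 0 ∧ d = c
        · obtain ⟨rfl, rfl⟩ := hj
          obtain rfl : d = i + 1 := by omega
          refine (RLe.of_end_E i (X := {E i, E 0} + W) (s := -2) ?_).of_eq
            (by simp only [Multiset.insert_eq_cons, ← Multiset.singleton_add]; abel) (by simp)
          exact (Mirror.lLe _ _ rfl (hW.cons_cons_E i)).cons_E_zero.of_eq
            (by simp only [Multiset.insert_eq_cons, ← Multiset.singleton_add]; abel) (by simp)
        · obtain ⟨e, he⟩ : ∃ e, e + i + 2 = d := ⟨d - 2 - i, by omega⟩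
          refine (RLe.of_mid_E (k := d) e i (by omega) (X := {E i, E j} + W)
            (s := -2) ?_).of_eq
            (by simp only [Multiset.insert_eq_cons, ← Multiset.singleton_add]; abel) (by simp)
          exact (ih _ e j (hW.cons_cons_E i) (by omega)
            (by simp [size, Path.nl, Path.nr] at hn ⊢; omega)).of_eq
            (by simp only [Multiset.insert_eq_cons, ← Multiset.singleton_add]; abel) (by simp)
    · cases lOpt_singleton.1 h' with
      | E_end b =>
        rcases c with _ | c
        · obtain rfl : b = 0 := by omega
          refine (RLe.of_one_M (X := {E 0} + W) (s := -1) ?_).of_eq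
            (by simp only [← Multiset.singleton_add]; abel) (by simp)
          exact (Mirror.lLe _ _ rfl hW).cons_E_zero.of_eq
            (by simp only [← Multiset.singleton_add]) (by simp)
        · refine (RLe.of_end_M c (X := {E b} + W) (s := -1) ?_).of_eq
            (by simp only [← Multiset.singleton_add]; abel) (by simp)
          exact (ih _ c b hW (by omega) (by simp [size, Path.nl, Path.nr] at hn ⊢; omega)).of_eq
            (by simp only [← Multiset.singleton_add]) (by simp)
      | E_mid _ i j h =>
        by_cases hj : j = 0 ∧ d = c + 1
        · obtain ⟨rfl, rfl⟩ := hj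
          obtain rfl : c = i + 1 := by omega
          refine (RLe.of_end_M i (X := {P i, E 0} + W) (s := -2) ?_).of_eq
            (by simp only [Multiset.insert_eq_cons, ← Multiset.singleton_add]; abel) (by simp)
          exact (Mirror.lLe _ _ rfl (hW.cons_cons_P i)).cons_E_zero.of_eq
            (by simp only [Multiset.insert_eq_cons, ← Multiset.singleton_add]; abel) (by simp)
        · obtain ⟨e, he⟩ : ∃ e, i + e + 2 = c := ⟨c - 2 - i, by omega⟩
          refine (RLe.of_mid_M (k := c) i e (by omega) (X := {P i, E j} + W)
            (s := -2) ?_).of_eq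
            (by simp only [Multiset.insert_eq_cons, ← Multiset.singleton_add]; abel) (by simp)
          exact (ih _ e j (hW.cons_cons_P i) (by omega)
            (by simp [size, Path.nl, Path.nr] at hn ⊢; omega)).of_eq
            (by simp only [Multiset.insert_eq_cons, ← Multiset.singleton_add]; abel) (by simp)
  · rw [← e]
    exact ih _ _ _ hW' hcd (by rw [e]; omega)

/-! ### Bounds for a single path -/

theorem lLe_E (k : ℕ) : LLe {E k} 4 := by
  have h : EvenPos k {E k} := by simp [EvenPos]
  simpa using h.lLe

/-- Right cuts as centrally as possible, gaining 3 and leaving pieces whose lengths differ by one,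
worth at most 1 to Left. -/
theorem rLe_E (k : ℕ) (hk : 1 ≤ k) : RLe {E k} (-2) := by
  obtain ⟨k, rfl⟩ := Nat.exists_eq_add_of_le' hk
  rcases k with _ | k
  · refine RLe.of_end_E 0 (X := 0) ?_
    simpa using (Mirror.lLe _ _ rfl Mirror.zero).cons_E_zero
  · rcases Nat.even_or_odd' k with ⟨m, rfl | rfl⟩
    · refine RLe.of_mid_E (X := 0) m m (by omega) ?_
      exact (lLe_M_E _ 0 m m Mirror.zero (Or.inl rfl) rfl).mono (by norm_num)
    · refine RLe.of_mid_E (X := 0) m (m + 1) (by omega) ?_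
      exact (lLe_M_E _ 0 m (m + 1) Mirror.zero (Or.inr rfl) rfl).mono (by norm_num)

theorem lLe_P (k : ℕ) : LLe {P k} 5 := by
  simpa using EvenPos.lLe_cons_P _ 0 k 0 rfl (EvenPos.zero 0)

/-- Here the central vertex belongs to Right, and removing it leaves two equal even paths. -/
theorem rLe_P_of_odd (k : ℕ) (hk : Odd k) : RLe {P k} (-3) := by
  obtain ⟨m, rfl⟩ := hk
  refine RLe.of_mid_P (X := 0) m m (by omega) ?_
  simpa using Mirror.lLe _ _ rfl (Mirror.zero.cons_cons_E m)

theorem rLe_P (k : ℕ) (hk : 1 ≤ k) : RLe {P k} (-1) := by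
  rcases Nat.even_or_odd' k with ⟨m, rfl | rfl⟩
  · obtain ⟨m, rfl⟩ := Nat.exists_eq_add_of_le' (show 1 ≤ m by omega)
    refine RLe.of_mid_P (X := 0) (m + 1) m (by omega) ?_
    simpa using (almost_mirror_bounds _ 0 Mirror.zero).2.2.1 m rfl
  · exact (rLe_P_of_odd _ ⟨m, rfl⟩).mono (by norm_num)

/-- Left owns only interior vertices, so his first move leaves two even paths with Right to move. -/
theorem lLe_M (k : ℕ) : LLe {M k} 3 := by
  refine .mk (fun g Y hY => ?_) (fun h => ?_)
  · cases lOpt_singleton.1 hY with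
    | M_mid _ c d h =>
      have h : EvenPos (max c d) {E c, E d} := by simp [EvenPos]
      simpa using h.rLe
  · simp [Path.nl] at h
    simp [h, Path.nr]

theorem rLe_M (k : ℕ) (hk : 1 ≤ k) : RLe {M k} (-1) := by
  obtain ⟨k, rfl⟩ := Nat.exists_eq_add_of_le' hk
  rcases k with _ | k
  · refine RLe.of_end_M 0 (X := 0) ?_
    refine .mk (fun g Y hY => ?_) (by simp [Path.nr])
    cases lOpt_singleton.1 hY with
    | M_mid _ c d h => omega
  -- The cut isolates a Right vertex. Left then has to split `M k` if he can, and the balance is -3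
  -- + 3 - 1.
  · refine RLe.of_mid_M (X := 0) 0 k (by omega) ?_
    refine .mk (fun g Y hY => ?_) (fun h => ?_)
    · obtain ⟨W, hm, -⟩ | ⟨_, h', rfl⟩ := lOpt_cons.1 hY
      · cases hm with
        | M_mid _ c d h => omega
      · cases lOpt_singleton.1 h' with
        | M_mid _ c d h =>
          have h : EvenPos (max c d) {M 0, E c, E d} := by simp [EvenPos]
          simpa using h.rLe
    · simp [Path.nl] at h
      simp [h, Path.nr]

/-! ### Positions as sets of integers -/

/-- The vertices from `a` to `b - 1` form the path `c`, where `x` is a Left vertex if `x + p`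
is even. -/
def IsInterval (p a b : ℤ) : Path → Prop
  | E k => b = a + 2 * k
  | P k => Even (a + p) ∧ b = a + 2 * k + 1
  | M k => Odd (a + p) ∧ b = a + 2 * k + 1

/-- The set `S` splits into intervals, with gaps between them, that form the paths of `X`. -/
inductive Rep (p : ℤ) : Finset ℤ → Pos → Prop
  | empty : Rep p ∅ 0
  | ico (a b : ℤ) (c : Path) (h : IsInterval p a b c) : Rep p (Finset.Ico a b) {c}
  | union {S T : Finset ℤ} {X Y : Pos} (hS : Rep p S X) (hT : Rep p T Y)
      (h : ∀ s ∈ S, ∀ t ∈ T, s + 1 < t ∨ t + 1 < s) : Rep p (S ∪ T) (X + Y)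

theorem IsInterval.neg {p q a b : ℤ} {c : Path} (h : IsInterval p a b c) (hpq : Odd (q - p)) :
    IsInterval q a b c.neg := by
  rw [Int.odd_iff] at hpq
  cases c with
  | E k => exact h
  | P k =>
    obtain ⟨h, h'⟩ := h
    rw [Int.even_iff] at h
    exact ⟨by rw [Int.odd_iff]; omega, h'⟩
  | M k =>
    obtain ⟨h, h'⟩ := h
    rw [Int.odd_iff] at h
    exact ⟨by rw [Int.even_iff]; omega, h'⟩

theorem Rep.neg {p q : ℤ} {S : Finset ℤ} {X : Pos} (h : Rep p S X) (hpq : Odd (q - p)) :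
    Rep q S (Pos.neg X) := by
  induction h with
  | empty => exact .empty
  | ico a b c h => simpa using Rep.ico a b c.neg (h.neg hpq)
  | union hS hT h ihS ihT => simpa using ihS.union ihT h

theorem card_filter_even_Ico (p a : ℤ) (n : ℕ) :
    ((Finset.Ico a (a + n)).filter fun x => Even (x + p)).card =
      if Even (a + p) then (n + 1) / 2 else n / 2 := by
  induction n with
  | zero => simp
  | succ n ih =>
    have e : Finset.Ico a (a + (n + 1 : ℕ)) = insert (a + n) (Finset.Ico a (a + n)) := by
      ext x
      simp only [Finset.mem_Ico, Finset.mem_insert]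
      push_cast
      omega
    rw [e, Finset.filter_insert]
    have hn : Even (a + n + p) ↔ (Even (a + p) ↔ Even n) := by
      rw [show a + n + p = (a + p) + n by ring, Int.even_add, Int.even_coe_nat]
    split_ifs at ih ⊢ with h1 h2 h2
    · rw [Finset.card_insert_of_notMem (by simp), ih]
      have : Even n := (hn.1 h1).1 h2
      rw [Nat.even_iff] at this
      omega
    · rw [Finset.card_insert_of_notMem (by simp), ih]
      have : ¬ Even n := fun h => h2 ((hn.1 h1).2 h)
      rw [Nat.even_iff] at this
      omega
    · rw [ih]
      have : ¬ Even n := fun h => h1 (hn.2 ⟨fun _ => h, fun _ => h2⟩)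
      rw [Nat.even_iff] at this
      omega
    · rw [ih]
      have : Even n := by
        by_contra h
        exact h1 (hn.2 ⟨fun h' => absurd h' h2, fun h' => absurd h' h⟩)
      rw [Nat.even_iff] at this
      omega

theorem Rep.card_even {p : ℤ} {S : Finset ℤ} {X : Pos} (h : Rep p S X) :
    (S.filter fun x => Even (x + p)).card = nl X := by
  induction h with
  | empty => simp
  | ico a b c h =>
    rcases c with k | k | k
    · have e : b = a + (2 * k : ℕ) := by
        rw [h]
        push_cast
        ring
      rw [e, card_filter_even_Ico]
      simp only [nl_singleton, Path.nl]
      split_ifs <;> omega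
    · have e : b = a + (2 * k + 1 : ℕ) := by
        rw [h.2]
        push_cast
        ring
      rw [e, card_filter_even_Ico, if_pos h.1]
      simp only [nl_singleton, Path.nl]
      omega
    · have e : b = a + (2 * k + 1 : ℕ) := by
        rw [h.2]
        push_cast
        ring
      rw [e, card_filter_even_Ico, if_neg (Int.not_even_iff_odd.2 h.1)]
      simp only [nl_singleton, Path.nl]
      omega
  | @union S T X Y hS hT h ihS ihT =>
    rw [Finset.filter_union, Finset.card_union_of_disjoint, ihS, ihT, nl_add]
    refine Finset.disjoint_filter_filter (Finset.disjoint_left.2 fun x hx hx' => ?_)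
    have := h x hx x hx'
    omega

theorem Rep.card_odd {p : ℤ} {S : Finset ℤ} {X : Pos} (h : Rep p S X) :
    (S.filter fun x => Odd (x + p)).card = nr X := by
  have := (h.neg (q := p + 1) (by simp)).card_even
  simp only [← add_assoc, Int.even_add_one, Int.not_even_iff_odd, Pos.nl_neg] at this
  exact this

theorem Rep.card_eq {p : ℤ} {S : Finset ℤ} {X : Pos} (h : Rep p S X) : S.card = size X := by
  rw [size, ← h.card_even, ← h.card_odd,
    ← Finset.card_filter_add_card_filter_not (s := S) (p := fun x => Even (x + p))]
  simp only [Int.not_even_iff_odd]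

-- Moves as deletions of neighbourhoods

/-- The vertex `x` and its neighbours. -/
noncomputable def nbhd (x : ℤ) : Finset ℤ := Finset.Icc (x - 1) (x + 1)

theorem mem_nbhd {x y : ℤ} : y ∈ nbhd x ↔ x - 1 ≤ y ∧ y ≤ x + 1 := Finset.mem_Icc

theorem Rep.of_mid {p a b x : ℤ} {c d : Path} (ha : a ≤ x - 1) (hb : x + 2 ≤ b)
    (hc : IsInterval p a (x - 1) c) (hd : IsInterval p (x + 2) b d) :
    Rep p (Finset.Ico a b \ nbhd x) {c, d} := by
  have e : Finset.Ico a b \ nbhd x = Finset.Ico a (x - 1) ∪ Finset.Ico (x + 2) b := by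
    ext y
    simp only [Finset.mem_sdiff, Finset.mem_Ico, mem_nbhd, Finset.mem_union]
    omega
  rw [e]
  refine Rep.union (.ico _ _ _ hc) (.ico _ _ _ hd) fun s hs t ht => ?_
  rw [Finset.mem_Ico] at hs ht
  omega

theorem Rep.of_left {p a b : ℤ} {c : Path} (hc : IsInterval p (a + 2) b c) :
    Rep p (Finset.Ico a b \ nbhd a) {c} := by
  have e : Finset.Ico a b \ nbhd a = Finset.Ico (a + 2) b := by
    ext y
    simp only [Finset.mem_sdiff, Finset.mem_Ico, mem_nbhd]
    omega
  rw [e]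
  exact .ico _ _ _ hc

theorem Rep.of_right {p a b x : ℤ} {c : Path} (hb : b = x + 1) (hc : IsInterval p a (x - 1) c) :
    Rep p (Finset.Ico a b \ nbhd x) {c} := by
  have e : Finset.Ico a b \ nbhd x = Finset.Ico a (x - 1) := by
    ext y
    simp only [Finset.mem_sdiff, Finset.mem_Ico, mem_nbhd]
    omega
  rw [e]
  exact .ico _ _ _ hc

theorem Rep.of_one {p a : ℤ} : Rep p (Finset.Ico a (a + 1) \ nbhd a) 0 := by
  have e : Finset.Ico a (a + 1) \ nbhd a = ∅ := by
    refine Finset.sdiff_eq_empty_iff_subset.2 fun y hy => ?_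
    rw [Finset.mem_Ico] at hy
    rw [mem_nbhd]
    omega
  rw [e]
  exact .empty

theorem IsInterval.exists_lMove {p a b x : ℤ} {c : Path} (h : IsInterval p a b c)
    (hx : x ∈ Finset.Ico a b) (hxp : Even (x + p)) :
    ∃ g W, LMove c g W ∧ Rep p (Finset.Ico a b \ nbhd x) W := by
  rw [Finset.mem_Ico] at hx
  obtain ⟨i, hi⟩ := Int.eq_ofNat_of_zero_le (sub_nonneg.2 hx.1)
  obtain rfl : x = a + i := by linarith
  rw [Int.even_iff] at hxp
  rcases c with k | k | k
  · replace h : b = a + 2 * k := h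
    rcases Nat.even_or_odd' i with ⟨i, rfl | rfl⟩
    · rcases i with _ | i
      · obtain ⟨k, rfl⟩ := Nat.exists_eq_add_of_le' (show 1 ≤ k by omega)
        refine ⟨_, _, .E_end k, ?_⟩
        simp only [mul_zero, Nat.cast_zero, add_zero]
        exact .of_left (by simp only [IsInterval]; omega)
      · refine ⟨_, _, .E_mid k i (k - 2 - i) (by omega), .of_mid (by omega) (by omega) ?_ ?_⟩
        · exact ⟨by rw [Int.even_iff]; omega, by omega⟩
        · simp only [IsInterval]
          omega
    · by_cases hik : i + 1 = k
      · subst hik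
        exact ⟨_, _, .E_end i, .of_right (by omega) (by simp only [IsInterval]; omega)⟩
      · refine ⟨_, _, .E_mid k (k - 2 - i) i (by omega), ?_⟩
        -- The Left end of this even path is its right end, so the odd piece lies on the right.
        rw [Multiset.pair_comm]
        refine .of_mid (by omega) (by omega) ?_ ?_
        · simp only [IsInterval]
          omega
        · exact ⟨by rw [Int.even_iff]; omega, by omega⟩
  · obtain ⟨ha, h⟩ := h
    rw [Int.even_iff] at ha
    obtain ⟨i, rfl⟩ : ∃ j, i = 2 * j := ⟨i / 2, by omega⟩
    rcases i with _ | i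
    · simp only [mul_zero, Nat.cast_zero, add_zero]
      rcases k with _ | k
      · obtain rfl : b = a + 1 := by omega
        exact ⟨_, _, .P_one, .of_one⟩
      · exact ⟨_, _, .P_end k, .of_left ⟨by rw [Int.even_iff]; omega, by omega⟩⟩
    · by_cases hik : i + 1 = k
      · subst hik
        exact ⟨_, _, .P_end i, .of_right (by omega) ⟨by rw [Int.even_iff]; omega, by omega⟩⟩
      · exact ⟨_, _, .P_mid k i (k - 2 - i) (by omega), .of_mid (by omega) (by omega)
          ⟨by rw [Int.even_iff]; omega, by omega⟩ ⟨by rw [Int.even_iff]; omega, by omega⟩⟩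
  · obtain ⟨ha, h⟩ := h
    rw [Int.odd_iff] at ha
    obtain ⟨i, rfl⟩ : ∃ j, i = 2 * j + 1 := ⟨i / 2, by omega⟩
    exact ⟨_, _, .M_mid k i (k - 1 - i) (by omega), .of_mid (by omega) (by omega)
      (by simp only [IsInterval]; omega) (by simp only [IsInterval]; omega)⟩

theorem IsInterval.exists_vertex {p a b : ℤ} {c : Path} {g : ℤ} {W : Pos} (h : IsInterval p a b c)
    (hm : LMove c g W) :
    ∃ x ∈ Finset.Ico a b, Even (x + p) ∧ Rep p (Finset.Ico a b \ nbhd x) W := by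
  simp only [Finset.mem_Ico]
  cases hm with
  | E_end k =>
    simp only [IsInterval] at h
    rcases Int.even_or_odd (a + p) with ha | ha
    · exact ⟨a, by omega, ha, .of_left (by simp only [IsInterval]; omega)⟩
    · rw [Int.odd_iff] at ha
      exact ⟨b - 1, by omega, by rw [Int.even_iff]; omega,
        .of_right (by omega) (by simp only [IsInterval]; omega)⟩
  | E_mid k i d hk =>
    simp only [IsInterval] at h
    rcases Int.even_or_odd (a + p) with ha | ha
    · rw [Int.even_iff] at ha
      refine ⟨a + 2 * i + 2, by omega, by rw [Int.even_iff]; omega,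
        .of_mid (by omega) (by omega) ⟨by rw [Int.even_iff]; omega, by omega⟩ ?_⟩
      simp only [IsInterval]
      omega
    · rw [Int.odd_iff] at ha
      refine ⟨a + 2 * d + 1, by omega, by rw [Int.even_iff]; omega, ?_⟩
      rw [Multiset.pair_comm]
      refine .of_mid (by omega) (by omega) ?_ ⟨by rw [Int.even_iff]; omega, by omega⟩
      simp only [IsInterval]
      omega
  | P_one =>
    obtain ⟨ha, h⟩ := h
    obtain rfl : b = a + 1 := by omega
    exact ⟨a, by omega, ha, .of_one⟩
  | P_end k =>
    obtain ⟨ha, h⟩ := h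
    rw [Int.even_iff] at ha
    exact ⟨a, by omega, by rw [Int.even_iff]; omega,
      .of_left ⟨by rw [Int.even_iff]; omega, by omega⟩⟩
  | P_mid k i d hk =>
    obtain ⟨ha, h⟩ := h
    rw [Int.even_iff] at ha
    exact ⟨a + 2 * i + 2, by omega, by rw [Int.even_iff]; omega, .of_mid (by omega) (by omega)
      ⟨by rw [Int.even_iff]; omega, by omega⟩ ⟨by rw [Int.even_iff]; omega, by omega⟩⟩
  | M_mid k i d hk =>
    obtain ⟨ha, h⟩ := h
    rw [Int.odd_iff] at ha
    exact ⟨a + 2 * i + 1, by omega, by rw [Int.even_iff]; omega, .of_mid (by omega) (by omega)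
      (by simp only [IsInterval]; omega) (by simp only [IsInterval]; omega)⟩

/-- The gap between components keeps a move in one from touching another. -/
theorem union_sdiff_nbhd {S T : Finset ℤ} {x : ℤ} (hx : x ∈ S)
    (h : ∀ s ∈ S, ∀ t ∈ T, s + 1 < t ∨ t + 1 < s) : (S ∪ T) \ nbhd x = S \ nbhd x ∪ T := by
  ext y
  have := h x hx y
  simp only [Finset.mem_sdiff, Finset.mem_union, mem_nbhd]
  constructor
  · tauto
  · rintro (h' | h')
    · tauto
    · have := this h'
      exact ⟨Or.inr h', by omega⟩

theorem Rep.exists_lOpt {p : ℤ} {S : Finset ℤ} {X : Pos} (h : Rep p S X) {x : ℤ} (hx : x ∈ S)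
    (hxp : Even (x + p)) : ∃ g Y, LOpt X g Y ∧ Rep p (S \ nbhd x) Y := by
  induction h with
  | empty => simp at hx
  | ico a b c h =>
    obtain ⟨g, W, hm, hW⟩ := h.exists_lMove hx hxp
    exact ⟨g, W, lOpt_singleton.2 hm, hW⟩
  | @union S T X Y hS hT h ihS ihT =>
    rcases Finset.mem_union.1 hx with hx | hx
    · obtain ⟨g, Z, ho, hZ⟩ := ihS hx
      refine ⟨g, Z + Y, lOpt_add.2 (Or.inl ⟨Z, ho, rfl⟩), ?_⟩
      rw [union_sdiff_nbhd hx h]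
      exact hZ.union hT fun s hs => h s (Finset.mem_sdiff.1 hs).1
    · obtain ⟨g, Z, ho, hZ⟩ := ihT hx
      refine ⟨g, X + Z, lOpt_add.2 (Or.inr ⟨Z, ho, rfl⟩), ?_⟩
      rw [Finset.union_comm, union_sdiff_nbhd hx fun s hs t ht => (h t ht s hs).symm,
        Finset.union_comm]
      exact hS.union hZ fun s hs t ht => h s hs t (Finset.mem_sdiff.1 ht).1

/-- The converse of `Rep.exists_lOpt`. Upper bounds need every actual Left move to be an abstract
one, and, after exchanging the players, each abstract reply of Right to be playable. -/
theorem Rep.exists_vertex {p : ℤ} {S : Finset ℤ} {X Y : Pos} {g : ℤ} (h : Rep p S X)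
    (ho : LOpt X g Y) : ∃ x ∈ S, Even (x + p) ∧ Rep p (S \ nbhd x) Y := by
  induction h generalizing Y with
  | empty => exact absurd ho not_lOpt_zero
  | ico a b c h => exact h.exists_vertex (lOpt_singleton.1 ho)
  | @union S T X₁ X₂ hS hT h ihS ihT =>
    rcases lOpt_add.1 ho with ⟨Z, hZ, rfl⟩ | ⟨Z, hZ, rfl⟩
    · obtain ⟨x, hx, hxp, hZ⟩ := ihS hZ
      refine ⟨x, Finset.mem_union_left _ hx, hxp, ?_⟩
      rw [union_sdiff_nbhd hx h]
      exact hZ.union hT fun s hs => h s (Finset.mem_sdiff.1 hs).1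
    · obtain ⟨x, hx, hxp, hZ⟩ := ihT hZ
      refine ⟨x, Finset.mem_union_right _ hx, hxp, ?_⟩
      rw [Finset.union_comm, union_sdiff_nbhd hx fun s hs t ht => (h t ht s hs).symm,
        Finset.union_comm]
      exact hS.union hZ fun s hs t ht => h s hs t (Finset.mem_sdiff.1 ht).1

end SegmentGame

namespace InfluenceGraph

variable {V : Type*} [DecidableEq V]

/-! ### The two scores add up to the number of vertices -/

theorem card_verts_remove {G : InfluenceGraph V} {S : Finset V} (hS : S ⊆ G.verts) :
    (G.remove S).verts.card + S.card = G.verts.card := by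
  have : (G.remove S).verts = G.verts \ S := by
    simp [verts, remove, Finset.union_sdiff_distrib]
  rw [this, Finset.card_sdiff_add_card_eq_card hS]

theorem succ_subset (G : InfluenceGraph V) (x : V) : G.succ x ⊆ G.verts := by
  classical exact Finset.filter_subset _ _

theorem pred_subset (G : InfluenceGraph V) (x : V) : G.pred x ⊆ G.verts := by
  classical exact Finset.filter_subset _ _

theorem sup'_add_inf' {ι : Type*} {s : Finset ι} (hs : s.Nonempty) {f g : ι → ℕ} {N : ℕ}
    (h : ∀ x ∈ s, f x + g x = N) : s.sup' hs f + s.inf' hs g = N := by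
  obtain ⟨x, hx, hfx⟩ := s.exists_mem_eq_sup' hs f
  obtain ⟨y, hy, hgy⟩ := s.exists_mem_eq_inf' hs g
  have h1 := s.le_sup' f hy
  have h2 := s.inf'_le g hx
  have := h x hx
  have := h y hy
  omega

theorem scores_add (G : InfluenceGraph V) :
    s1L G + s2R G = G.verts.card ∧ s2L G + s1R G = G.verts.card := by
  induction h : G.verts.card using Nat.strong_induction_on generalizing G with
  | _ n ih =>
  subst h
  constructor
  · rw [s1L, s2R]
    split_ifs with hL
    · refine sup'_add_inf' _ fun x _ => ?_
      have h1 := (ih _ (G.card_remove_succ_lt x.2) _ rfl).2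
      have h2 := card_verts_remove (G.succ_subset x.1)
      omega
    · simp
  · rw [s2L, s1R]
    split_ifs with hR
    · rw [add_comm]
      refine sup'_add_inf' _ fun y _ => ?_
      have h1 := (ih _ (G.card_remove_pred_lt y.2) _ rfl).1
      have h2 := card_verts_remove (G.pred_subset y.1)
      omega
    · simp

/-- This reduces the difference of scores to one recursion and fixes its parity. -/
theorem Ls_eq (G : InfluenceGraph V) : G.Ls = 2 * s1L G - G.verts.card := by
  have := (scores_add G).1
  rw [Ls]
  omega

theorem Rs_eq (G : InfluenceGraph V) : G.Rs = 2 * s2L G - G.verts.card := by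
  have := (scores_add G).2
  rw [Rs]
  omega

theorem Ls_le {G : InfluenceGraph V} {s : ℤ}
    (h : ∀ x ∈ G.L, (G.remove (G.succ x)).Rs ≤ s - (G.succ x).card)
    (h0 : G.L = ∅ → -(G.verts.card : ℤ) ≤ s) : G.Ls ≤ s := by
  rw [Ls_eq, s1L]
  split_ifs with hL
  · obtain ⟨x, -, hx⟩ := G.L.attach.exists_mem_eq_sup' (by simpa using hL)
      (fun x => (G.succ x.1).card + s2L (G.remove (G.succ x.1)))
    rw [hx]
    have h1 := h x.1 x.2
    have h2 := card_verts_remove (G.succ_subset x.1)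
    rw [Rs_eq] at h1
    push_cast
    omega
  · simpa using h0 (Finset.not_nonempty_iff_eq_empty.1 hL)

theorem Rs_le {G : InfluenceGraph V} {s : ℤ} {y : V} (hy : y ∈ G.R)
    (h : (G.remove (G.pred y)).Ls ≤ s + (G.pred y).card) : G.Rs ≤ s := by
  rw [Rs_eq, s2L, dif_pos ⟨y, hy⟩]
  have h1 := G.R.attach.inf'_le (fun y => s1L (G.remove (G.pred y.1))) (Finset.mem_attach _ ⟨y, hy⟩)
  have h2 := card_verts_remove (G.pred_subset y)
  rw [Ls_eq] at h
  have h3 : ((G.R.attach.inf' ⟨_, Finset.mem_attach _ ⟨y, hy⟩⟩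
    (fun y => s1L (G.remove (G.pred y.1))) : ℕ) : ℤ) ≤ s1L (G.remove (G.pred y)) := by
    exact_mod_cast h1
  omega

theorem Rs_of_R_eq_empty {G : InfluenceGraph V} (h : G.R = ∅) : G.Rs = G.verts.card := by
  rw [Rs_eq, s2L, dif_neg (by simp [h])]
  ring

-- Symmetry between the players

/-- Exchange the two players. -/
def rev (G : InfluenceGraph V) : InfluenceGraph V where
  L := G.R
  R := G.L
  arc x y := G.arc y x
  disjoint_LR := G.disjoint_LR.symm
  arc_mem x y h := ⟨(G.arc_mem y x h).2.symm, (G.arc_mem y x h).1.symm⟩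

theorem verts_rev (G : InfluenceGraph V) : G.rev.verts = G.verts := Finset.union_comm _ _

theorem succ_rev (G : InfluenceGraph V) (x : V) : G.rev.succ x = G.pred x := by
  ext z
  simp only [succ, pred, verts_rev, Finset.mem_filter]
  exact and_congr_right fun _ => Relation.reflTransGen_swap

theorem pred_rev (G : InfluenceGraph V) (x : V) : G.rev.pred x = G.succ x := by
  ext z
  simp only [succ, pred, verts_rev, Finset.mem_filter]
  exact and_congr_right fun _ => Relation.reflTransGen_swap

theorem remove_rev (G : InfluenceGraph V) (S : Finset V) : G.rev.remove S = (G.remove S).rev := by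
  simp only [remove, rev, mk.injEq, true_and]
  ext x y
  tauto

theorem score_rev (G : InfluenceGraph V) : s1L G.rev = s1R G ∧ s2L G.rev = s2R G := by
  induction h : G.verts.card using Nat.strong_induction_on generalizing G with
  | _ n ih =>
  subst h
  constructor
  · rw [s1L, s1R]
    refine dite_congr rfl (fun hR => ?_) fun _ => rfl
    refine Finset.sup'_congr _ rfl fun y _ => ?_
    rw [succ_rev, remove_rev, (ih _ (G.card_remove_pred_lt y.2) _ rfl).2]
  · rw [s2L, s2R]
    refine dite_congr rfl (fun hR => ?_) fun _ => by rw [verts_rev]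
    refine Finset.inf'_congr _ rfl fun x _ => ?_
    rw [pred_rev, remove_rev, (ih _ (G.card_remove_succ_lt x.2) _ rfl).1]

theorem Ls_rev (G : InfluenceGraph V) : G.rev.Ls = -G.Rs := by
  have h1 := (score_rev G).1
  have h2 := (scores_add G).2
  rw [Ls_eq, Rs_eq, verts_rev, h1]
  omega

theorem Rs_rev (G : InfluenceGraph V) : G.rev.Rs = -G.Ls := by
  have h1 := (score_rev G).2
  have h2 := (scores_add G).1
  rw [Ls_eq, Rs_eq, verts_rev, h1]
  omega

/-! ### Sets of integers as graphs -/

/-- `G` is the alternating graph on `S` in which `x` is a Left vertex if `x + p` is even. -/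
structure IsAlternating (p : ℤ) (S : Finset ℤ) (G : InfluenceGraph ℤ) : Prop where
  mem_L : ∀ i, i ∈ G.L ↔ i ∈ S ∧ Even (i + p)
  mem_R : ∀ i, i ∈ G.R ↔ i ∈ S ∧ Odd (i + p)
  arc_iff : ∀ i j, G.arc i j ↔ i ∈ S ∧ j ∈ S ∧ Even (i + p) ∧ (j = i + 1 ∨ j = i - 1)

namespace IsAlternating

variable {p : ℤ} {S : Finset ℤ} {G : InfluenceGraph ℤ}

theorem verts_eq (h : IsAlternating p S G) : G.verts = S := by
  ext i
  rw [verts, Finset.mem_union, h.mem_L, h.mem_R, ← and_or_left]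
  exact and_iff_left (Int.even_or_odd _)

theorem remove (h : IsAlternating p S G) (T : Finset ℤ) :
    IsAlternating p (S \ T) (G.remove T) where
  mem_L i := by simp [InfluenceGraph.remove, h.mem_L, and_right_comm]
  mem_R i := by simp [InfluenceGraph.remove, h.mem_R, and_right_comm]
  arc_iff i j := by
    simp only [InfluenceGraph.remove, h.arc_iff, Finset.mem_sdiff]
    tauto

theorem rev (h : IsAlternating p S G) : IsAlternating (p + 1) S G.rev where
  mem_L i := by
    rw [← add_assoc, Int.even_add_one, Int.not_even_iff_odd]
    exact h.mem_R i
  mem_R i := by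
    rw [← add_assoc, ← Int.not_even_iff_odd, Int.even_add_one, not_not]
    exact h.mem_L i
  arc_iff i j := by
    refine (h.arc_iff j i).trans ?_
    simp only [Int.even_iff]
    constructor
    · rintro ⟨h1, h2, h3, h4⟩
      exact ⟨h2, h1, by omega, by omega⟩
    · rintro ⟨h1, h2, h3, h4⟩
      exact ⟨h2, h1, by omega, by omega⟩

/-- No two arcs are composable: arcs start at Left vertices and end at Right ones. -/
theorem succ_eq (h : IsAlternating p S G) {x : ℤ} (hx : x ∈ S) (hxp : Even (x + p)) :
    G.succ x = S ∩ SegmentGame.nbhd x := by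
  ext z
  simp only [succ, h.verts_eq, Finset.mem_filter, Finset.mem_inter, SegmentGame.mem_nbhd]
  refine and_congr_right fun hz => ⟨fun hr => ?_, fun hr => ?_⟩
  · induction hr with
    | refl => omega
    | @tail b c hb hc ih =>
      obtain ⟨h1, -, h2, h3⟩ := (h.arc_iff b c).1 hc
      have h4 := ih h1
      rw [Int.even_iff] at h2 hxp
      omega
  · by_cases hzx : z = x
    · subst hzx
      exact .refl
    · exact .single ((h.arc_iff x z).2 ⟨hx, hz, hxp, by omega⟩)

theorem pred_eq (h : IsAlternating p S G) {x : ℤ} (hx : x ∈ S) (hxp : Odd (x + p)) :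
    G.pred x = S ∩ SegmentGame.nbhd x := by
  rw [← succ_rev]
  refine h.rev.succ_eq hx ?_
  rw [← add_assoc]
  exact hxp.add_one

end IsAlternating

end InfluenceGraph

-- From certificates to scores

namespace SegmentGame

open SegmentGame.Path SegmentGame.Pos InfluenceGraph

theorem scores_le (n : ℕ) : ∀ (p : ℤ) (S : Finset ℤ) (G : InfluenceGraph ℤ) (X : Pos),
    S.card = n → IsAlternating p S G → Rep p S X →
      (∀ s, LLe X s → G.Ls ≤ s) ∧ ∀ s, RLe X s → G.Rs ≤ s := by
  induction n using Nat.strong_induction_on with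
  | _ n ih =>
  intro p S G X hn hG hX
  have key : ∀ (x : ℤ) (g : ℤ) (Y : Pos), x ∈ S → Rep p (S \ nbhd x) Y →
      (size X : ℤ) = g + size Y → ((S ∩ nbhd x).card : ℤ) = g ∧ (S \ nbhd x).card < n := by
    intro x g Y hx hY hs
    have h1 := hX.card_eq
    have h2 := hY.card_eq
    have h3 := Finset.card_inter_add_card_sdiff S (nbhd x)
    have h4 : 0 < (S ∩ nbhd x).card :=
      Finset.card_pos.2 ⟨x, Finset.mem_inter.2 ⟨hx, mem_nbhd.2 (by omega)⟩⟩
    omega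
  constructor
  · rintro s ⟨h, h0⟩
    refine Ls_le (fun x hx => ?_) fun hL => ?_
    · obtain ⟨hxS, hxp⟩ := (hG.mem_L x).1 hx
      obtain ⟨g, Y, hY, hYR⟩ := hX.exists_lOpt hxS hxp
      obtain ⟨hc, hlt⟩ := key x g Y hxS hYR hY.size_eq
      rw [hG.succ_eq hxS hxp, hc]
      have hG' := hG.remove (S ∩ nbhd x)
      rw [Finset.sdiff_inter_self_left] at hG'
      exact (ih _ hlt p _ _ Y rfl hG' hYR).2 _ (h g Y hY)
    · have hnl : nl X = 0 := by
        rw [← hX.card_even, Finset.card_eq_zero, Finset.filter_eq_empty_iff]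
        intro x hx hxp
        have := (hG.mem_L x).2 ⟨hx, hxp⟩
        simp [hL] at this
      have := h0 hnl
      rw [hG.verts_eq, hX.card_eq, size, hnl]
      simpa using this
  · rintro s (⟨h, h'⟩ | ⟨h, h'⟩)
    · rename_i Y g
      obtain ⟨y, hyS, hyp, hYR⟩ := (hX.neg (q := p + 1) (by simp)).exists_vertex h
      have hyp' : Odd (y + p) := by
        rw [← add_assoc, Int.even_add_one, Int.not_even_iff_odd] at hyp
        exact hyp
      have hYR' : Rep p (S \ nbhd y) Y := by
        simpa using hYR.neg (q := p) (by simp)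
      have hs := h.size_eq
      rw [size_neg, size_neg] at hs
      obtain ⟨hc, hlt⟩ := key y g Y hyS hYR' hs
      refine Rs_le ((hG.mem_R y).2 ⟨hyS, hyp'⟩) ?_
      rw [hG.pred_eq hyS hyp', hc]
      have hG' := hG.remove (S ∩ nbhd y)
      rw [Finset.sdiff_inter_self_left] at hG'
      exact (ih _ hlt p _ _ Y rfl hG' hYR').1 _ h'
    · have hR : G.R = ∅ := by
        rw [← hX.card_odd, Finset.card_eq_zero, Finset.filter_eq_empty_iff] at h
        refine Finset.eq_empty_of_forall_notMem fun x hx => ?_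
        exact h ((hG.mem_R x).1 hx).1 ((hG.mem_R x).1 hx).2
      rw [Rs_of_R_eq_empty hR, hG.verts_eq, hX.card_eq, size, h]
      simpa using h'

theorem le_scores {p : ℤ} {S : Finset ℤ} {G : InfluenceGraph ℤ} {X : Pos}
    (hG : IsAlternating p S G) (hX : Rep p S X) (s : ℤ) :
    (LLe (Pos.neg X) s → -s ≤ G.Rs) ∧ (RLe (Pos.neg X) s → -s ≤ G.Ls) := by
  obtain ⟨h1, h2⟩ := scores_le _ _ _ _ _ rfl hG.rev (hX.neg (by simp))
  constructor
  · intro h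
    have := h1 s h
    rw [Ls_rev] at this
    linarith
  · intro h
    have := h2 s h
    rw [Rs_rev] at this
    linarith

end SegmentGame

-- Segments

namespace InfluenceGraph

open SegmentGame SegmentGame.Path

theorem IsSegment.isAlternating {G : InfluenceGraph ℤ} (h : G.IsSegment) :
    IsAlternating 0 G.verts G where
  mem_L i := by simpa using h.mem_L i
  mem_R i := by simpa using h.mem_R i
  arc_iff i j := by simpa using h.arc_iff i j

theorem IsSegment.exists_path {G : InfluenceGraph ℤ} (h : G.IsSegment) :
    ∃ c, Rep 0 G.verts {c} := by
  have hne : G.verts.Nonempty := Finset.card_pos.1 (by have := h.two_le_card; omega)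
  set a := G.verts.min' hne with ha
  set b := G.verts.max' hne with hb
  have e : G.verts = Finset.Ico a (b + 1) := by
    ext x
    rw [Finset.mem_Ico]
    constructor
    · intro hx
      have h1 := G.verts.min'_le x hx
      have h2 := G.verts.le_max' x hx
      omega
    · intro hx
      exact h.consecutive a b x (G.verts.min'_mem hne) (G.verts.max'_mem hne) hx.1 (by omega)
  have hab : a ≤ b := G.verts.min'_le b (G.verts.max'_mem hne)
  rw [e]
  obtain ⟨n, hn⟩ := Int.eq_ofNat_of_zero_le (show 0 ≤ b + 1 - a by omega)
  rcases Nat.even_or_odd' n with ⟨k, rfl | rfl⟩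
  · exact ⟨E k, .ico _ _ _ (by simp only [IsInterval]; omega)⟩
  · rcases Int.even_or_odd a with hp | hp
    · exact ⟨P k, .ico _ _ _ ⟨by simpa using hp, by omega⟩⟩
    · exact ⟨M k, .ico _ _ _ ⟨by simpa using hp, by omega⟩⟩

end InfluenceGraph

open SegmentGame SegmentGame.Path InfluenceGraph in
theorem mainTheorem3 (G : InfluenceGraph ℤ) (hG : G.IsSegment) :
    (G.IsSegmentEq →
      (G.Ls = 2 ∨ G.Ls = 4) ∧ (G.Rs = -2 ∨ G.Rs = -4)) ∧
    (G.IsSegmentMinus →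
      (G.Ls = 1 ∨ G.Ls = 3) ∧ (G.Rs = -1 ∨ G.Rs = -3 ∨ G.Rs = -5) ∧
      (Odd G.L.card → G.Ls = 3)) ∧
    (G.IsSegmentPlus →
      (G.Ls = 1 ∨ G.Ls = 3 ∨ G.Ls = 5) ∧ (G.Rs = -1 ∨ G.Rs = -3) ∧
      (Even G.L.card → G.Rs = -3)) ∧
    (0 < G.Ls ∧ G.Ls ≤ 5 ∧ G.Rs < 0 ∧ -5 ≤ G.Rs) := by
  obtain ⟨c, hc⟩ := hG.exists_path
  have hA := hG.isAlternating
  obtain ⟨hL, hR⟩ := scores_le _ _ _ _ _ rfl hA hc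
  have hneg := le_scores hA hc
  rw [Pos.neg_singleton] at hneg
  have hcard := hc.card_eq
  have hLc : G.L.card = c.nl := by
    rw [← Pos.nl_singleton, ← hc.card_even]
    congr 1
    ext i
    simpa using hG.mem_L i
  have hRc : G.R.card = c.nr := by
    rw [← Pos.nr_singleton, ← hc.card_odd]
    congr 1
    ext i
    simpa using hG.mem_R i
  have h2 := hG.two_le_card
  have hLs := G.Ls_eq
  have hRs := G.Rs_eq
  simp only [IsSegmentEq, IsSegmentMinus, IsSegmentPlus, Nat.even_iff, Nat.odd_iff]
  rw [hLc, hRc]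
  rcases c with k | k | k <;>
    simp only [Pos.size, Pos.nl_singleton, Pos.nr_singleton, Path.nl, Path.nr] at hcard hLc hRc ⊢
  -- In each case parity, from `hLs`, `hRs` and `hcard`, leaves only the listed values between the
  -- bounds.
  · have b1 := hL 4 (lLe_E k)
    have b2 := hR (-2) (rLe_E k (by omega))
    have b3 := (hneg 4).1 (lLe_E k)
    have b4 := (hneg (-2)).2 (rLe_E k (by omega))
    omega
  · have b1 := hL 5 (lLe_P k)
    have b2 := hR (-1) (rLe_P k (by omega))
    have b3 := (hneg 3).1 (lLe_M k)
    have b4 := (hneg (-1)).2 (rLe_M k (by omega))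
    have b5 : k % 2 = 1 → G.Rs ≤ -3 := fun h => hR (-3) (rLe_P_of_odd k (Nat.odd_iff.2 h))
    omega
  · have b1 := hL 3 (lLe_M k)
    have b2 := hR (-1) (rLe_M k (by omega))
    have b3 := (hneg 5).1 (lLe_P k)
    have b4 := (hneg (-1)).2 (rLe_P k (by omega))
    have b5 : k % 2 = 1 → - -3 ≤ G.Ls := fun h => (hneg (-3)).2 (rLe_P_of_odd k (Nat.odd_iff.2 h))
    omega
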